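/- Let $X$ be a pseudocompact Tychonoff space, i.e. a completely regular Hausdorff space on which every continuous real-valued function is bounded. Let $C_k(X)$ denote the space of all continuous functions $X\to\mathbb{R}$ with the compact-open topology, let $\beta: X\to\beta X$ be the canonical embedding of $X$ into its Stone–Čech compactification, and let $C(\beta X)$ be the Banach space of all continuous functions $\beta X\to\mathbb{R}$ with the supremum norm. Then the following assertions are equivalent: (i) $X$ is selectively $\omega$-bounded, i.e. for every sequence $(U_n)_{n\in\omega}$ of nonempty open subsets of $X$ there are points $x_n\in U_n$ $(n\in\omega)$ and a subsequence $(x_{n_k})_{k\in\omega}$ of $(x_n)_{n\in\omega}$ such that the closure of $\{x_{n_k}:k\in\omega\}$ in $X$ is compact; (ii) the restriction map $\beta^*: C(\beta X)\to C_k(X)$, $\beta^*(f)=f\circ\beta$, is compact-covering, i.e. it is continuous and for every compact set $K\subseteq C_k(X)$ there is a compact set $C\subseteq C(\beta X)$ with $\beta^*(C)=K$; (iii) $X$ is an Ascoli space, i.e. every compact subset of $C_k(X)$ is equicontinuous (at every point of $X$); (iv) $X$ is a sequentially Ascoli space, i.e. for every sequence $(f_n)_{n\in\omega}$ converging in $C_k(X)$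 to some $g\in C_k(X)$, the set $\{f_n:n\in\omega\}\cup\{g\}$ is equicontinuous (at every point of $X$). -/

import Mathlib

open Set Filter Topology

/-- A space is pseudocompact if every continuous real-valued function on it is bounded. -/
def IsPseudocompact (X : Type*) [TopologicalSpace X] : Prop :=
  ∀ f : C(X, ℝ), ∃ M : ℝ, ∀ x : X, |f x| ≤ M

/-- A space is selectively `ω`-bounded if from every sequence of nonempty open sets one can select
a sequence of points having a subsequence whose closure is compact. -/
def IsSelectivelyOmegaBounded (X : Type*) [TopologicalSpace X] : Prop :=
  ∀ U : ℕ → Set X, (∀ n, IsOpen (U n) ∧ (U n).Nonempty) →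
    ∃ x : ℕ → X, (∀ n, x n ∈ U n) ∧
      ∃ φ : ℕ → ℕ, StrictMono φ ∧ IsCompact (closure (range (x ∘ φ)))

/-- A continuous map is compact-covering if every compact subset of the codomain is the image of
a compact subset of the domain. -/
def IsCompactCovering {A B : Type*} [TopologicalSpace A] [TopologicalSpace B] (p : A → B) : Prop :=
  Continuous p ∧ ∀ K : Set B, IsCompact K → ∃ C : Set A, IsCompact C ∧ p '' C = K

/-- A set of continuous real-valued functions is equicontinuous (at every point).
The space `C(X, ℝ)` carries the compact-open topology. -/
def IsEquicontinuousSet {X : Type*} [TopologicalSpace X] (S : Set C(X, ℝ)) : Prop :=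
  Equicontinuous (fun (f : S) (x : X) => (f : C(X, ℝ)) x)

/-- A space `X` is Ascoli if every compact subset of `C(X, ℝ)`, with the compact-open topology,
is equicontinuous. -/
def IsAscoli (X : Type*) [TopologicalSpace X] : Prop :=
  ∀ K : Set C(X, ℝ), IsCompact K → IsEquicontinuousSet K

/-- A space `X` is sequentially Ascoli if every convergent sequence (together with its limit) in
`C(X, ℝ)`, with the compact-open topology, is equicontinuous. -/
def IsSequentiallyAscoli (X : Type*) [TopologicalSpace X] : Prop :=
  ∀ (f : ℕ → C(X, ℝ)) (g : C(X, ℝ)), Tendsto f atTop (𝓝 g) →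
    IsEquicontinuousSet (insert g (range f))

/-- The restriction map `β* : C(βX) → C(X)`, `β*(f) = f ∘ β`, where `β : X → βX` is the canonical
map into the Stone-Čech compactification. Since `βX` is compact, the compact-open topology on
`C(βX)` is the topology of the supremum norm. -/
def stoneCechRestrict (X : Type*) [TopologicalSpace X] (f : C(StoneCech X, ℝ)) : C(X, ℝ) :=
  f.comp ⟨stoneCechUnit, continuous_stoneCechUnit⟩

/-! If the restriction map from `C(βX, ℝ)` is compact-covering, then `X` is Ascoli, because a
compact set of functions on the compact space `βX` is equicontinuous. An Ascoli space is
sequentially Ascoli, because a convergent sequence together with its limit is compact.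

For a compact set `K ⊆ C(X, ℝ)`, equicontinuity of `K` amounts to continuity of the evaluation map
`x ↦ (f ↦ f x)` from `X` to the Banach space `C(K, ℝ)`. If `X` is pseudocompact, the image of this
map is a pseudocompact metrizable space, hence compact (`IsPseudocompact.isCompact_range`), so the
map extends to `βX`. Exchanging the two variables again turns the extension into a continuous map `K
→ C(βX, ℝ)`, a lift of `K` along the restriction map, with compact image. So the restriction map is
compact-covering if `X` is Ascoli.

Let `X` be selectively `ω`-bounded. The failure of equicontinuity of `K` at `x₀` yields functions `f
n ∈ K` and nonempty open sets `U n` such that on `U n` the function `f n` is far from `f n x₀` while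
each earlier `f m` is close to `f m x₀`. Points `y n ∈ U n` running in a compact set on a
subsequence have a cluster point `z` at which every `f n` is still close to `f n x₀`, so `K`
restricted to that compact set is not equicontinuous at `z`, which is impossible.

If a sequence `U` violates selective `ω`-boundedness, then every compact set meets only finitely
many of the `U n`, so bump functions supported in the `U n` converge to `0` in the compact-open
topology. Pseudocompactness yields a point each of whose neighbourhoods meets infinitely many of the
sets where the bump functions exceed `1/2` (`IsPseudocompact.exists_frequently_inter_nonempty`), and
the bump functions are not equicontinuous there, so `X` is not sequentially Ascoli. -/

/-! ### Pseudocompact spaces -/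

/-- Otherwise the `V n` are locally finite, and the sum of bump functions of height `n`
supported in `V n` is an unbounded continuous function. -/
theorem IsPseudocompact.exists_frequently_inter_nonempty {X : Type*} [TopologicalSpace X]
    [CompletelyRegularSpace X] (hX : IsPseudocompact X) {V : ℕ → Set X}
    (hVo : ∀ n, IsOpen (V n)) (hVne : ∀ n, (V n).Nonempty) :
    ∃ x : X, ∀ W ∈ 𝓝 x, ∃ᶠ n in atTop, (V n ∩ W).Nonempty := by
  by_contra! hcon
  have hlf : LocallyFinite V := by
    intro x
    obtain ⟨W, hW, hWV⟩ := hcon x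
    refine ⟨W, hW, ?_⟩
    rw [← Nat.cofinite_eq_atTop] at hWV
    simpa [Filter.eventually_cofinite, ← nonempty_iff_ne_empty] using hWV
  choose p hp using hVne
  have hbump (n : ℕ) : ∃ g : C(X, ℝ), g (p n) = n ∧ (∀ x, 0 ≤ g x) ∧ ∀ x ∉ V n, g x = 0 := by
    obtain ⟨g, hg, hgp, hgV⟩ := CompletelyRegularSpace.completely_regular (p n) (V n)ᶜ
      (hVo n).isClosed_compl (by simpa using hp n)
    refine ⟨⟨fun x => n * (1 - (g x : ℝ)), by fun_prop⟩, by simp [hgp], fun x => ?_, fun x hx => ?_⟩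
    · exact mul_nonneg n.cast_nonneg (sub_nonneg.2 (g x).2.2)
    · simp [hgV hx]
  choose g hgp hg0 hgV using hbump
  have hsupp (n : ℕ) : Function.support (g n) ⊆ V n := fun x hx => by
    by_contra h
    exact hx (hgV n x h)
  have hlf' : LocallyFinite fun n => Function.support (g n) := hlf.subset hsupp
  obtain ⟨M, hM⟩ := hX ⟨fun x => ∑ᶠ n, g n x, continuous_finsum (fun n => (g n).continuous) hlf'⟩
  obtain ⟨n, hn⟩ := exists_nat_gt M
  have hle : g n (p n) ≤ ∑ᶠ m, g m (p n) :=
    single_le_finsum n (hlf'.point_finite (p n)) fun m => hg0 m (p n)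
  have := (le_abs_self _).trans (hM (p n))
  simp only [ContinuousMap.coe_mk] at this
  linarith [hgp n]

theorem IsPseudocompact.isCompact_range {X M : Type*} [TopologicalSpace X]
    [PseudoMetricSpace M] (hX : IsPseudocompact X) {f : X → M} (hf : Continuous f) :
    IsCompact (range f) := by
  have hR : IsPseudocompact (range f) := fun g => by
    obtain ⟨B, hB⟩ := hX (g.comp ⟨rangeFactorization f, hf.rangeFactorization⟩)
    refine ⟨B, ?_⟩
    rintro ⟨_, x, rfl⟩
    exact hB x
  rw [isCompact_iff_compactSpace, compactSpace_iff_seqCompactSpace]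
  refine ⟨fun y _ => ?_⟩
  -- A cluster point of shrinking balls around the terms is a cluster point of the sequence.
  obtain ⟨z, hz⟩ := hR.exists_frequently_inter_nonempty
    (V := fun n => Metric.ball (y n) (1 / ((n : ℝ) + 1))) (fun n => Metric.isOpen_ball)
    fun n => ⟨y n, Metric.mem_ball_self Nat.one_div_pos_of_nat⟩
  have hcl : MapClusterPt z atTop y := by
    rw [Metric.nhds_basis_ball.mapClusterPt_iff_frequently]
    intro ε hε
    have hsmall : ∀ᶠ n : ℕ in atTop, 1 / ((n : ℝ) + 1) < ε / 2 :=
      tendsto_one_div_add_atTop_nhds_zero_nat.eventually (gt_mem_nhds (half_pos hε))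
    refine ((hz _ (Metric.ball_mem_nhds z (half_pos hε))).and_eventually hsmall).mono ?_
    rintro n ⟨⟨w, hw1, hw2⟩, hn⟩
    rw [Metric.mem_ball] at hw1 hw2 ⊢
    linarith [dist_triangle_left (y n) z w]
  obtain ⟨φ, hφ, hlim⟩ := hcl.tendsto_subseq
  exact ⟨z, mem_univ z, φ, hφ, hlim⟩

/-! ### Equicontinuity and evaluation maps -/

theorem isEquicontinuousSet_iff {X : Type*} [TopologicalSpace X] {S : Set C(X, ℝ)} :
    IsEquicontinuousSet S ↔
      ∀ x, ∀ ε > 0, ∀ᶠ y in 𝓝 x, ∀ f ∈ S, |f x - f y| < ε := by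
  simp [IsEquicontinuousSet, Equicontinuous, Metric.equicontinuousAt_iff_right, Real.dist_eq]

/-- The map `x ↦ (f ↦ f x)` into the functions on `K` is continuous for the topology of uniform
convergence. -/
theorem IsEquicontinuousSet.exists_continuous_eval {X : Type*} [TopologicalSpace X]
    {K : Set C(X, ℝ)} [CompactSpace K] (hK : IsEquicontinuousSet K) :
    ∃ Φ : X → C(K, ℝ), Continuous Φ ∧ ∀ x f, Φ x f = (f : C(X, ℝ)) x := by
  refine ⟨fun x => ⟨fun f => (f : C(X, ℝ)) x,
    by fun_prop⟩, ?_, fun _ _ => rfl⟩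
  rw [continuous_iff_continuousAt]
  intro x
  rw [ContinuousAt, Metric.tendsto_nhds]
  intro ε hε
  filter_upwards [isEquicontinuousSet_iff.1 hK x ε hε] with y hy
  rw [ContinuousMap.dist_lt_iff hε]
  intro f
  rw [dist_comm]
  exact hy f f.2

theorem IsCompact.isEquicontinuousSet {Y : Type*} [TopologicalSpace Y] [LocallyCompactSpace Y]
    {K : Set C(Y, ℝ)} (hK : IsCompact K) : IsEquicontinuousSet K := by
  have : CompactSpace K := isCompact_iff_compactSpace.1 hK
  let F : C(Y × K, ℝ) := ⟨fun p => (p.2 : C(Y, ℝ)) p.1, by fun_prop⟩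
  rw [isEquicontinuousSet_iff]
  intro x ε hε
  have h := Metric.tendsto_nhds.1 (F.curry.continuous.tendsto x) ε hε
  filter_upwards [h] with y hy f hf
  rw [dist_comm] at hy
  exact (ContinuousMap.dist_lt_iff hε).1 hy ⟨f, hf⟩

theorem IsEquicontinuousSet.image_comp {X Y : Type*} [TopologicalSpace X] [TopologicalSpace Y]
    {S : Set C(Y, ℝ)} (hS : IsEquicontinuousSet S) (g : C(X, Y)) :
    IsEquicontinuousSet ((fun f : C(Y, ℝ) => f.comp g) '' S) := by
  rw [isEquicontinuousSet_iff] at hS ⊢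
  intro x ε hε
  filter_upwards [g.continuous.continuousAt.eventually (hS (g x) ε hε)] with y hy
  rintro _ ⟨f, hf, rfl⟩
  exact hy f hf

/-! ### Selective `ω`-boundedness, compact-covering restriction and Ascoli properties -/

theorem IsSelectivelyOmegaBounded.isAscoli {X : Type*} [TopologicalSpace X] [R1Space X]
    (hX : IsSelectivelyOmegaBounded X) : IsAscoli X := by
  intro K hK
  rw [isEquicontinuousSet_iff]
  by_contra! hcon
  obtain ⟨x₀, ε, hε, hfreq⟩ := hcon
  have hnear (f : C(X, ℝ)) : ∀ᶠ y in 𝓝 x₀, |f x₀ - f y| < ε / 2 := by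
    have h : Continuous fun y => |f x₀ - f y| := by fun_prop
    exact h.continuousAt.eventually (gt_mem_nhds (by simpa using half_pos hε))
  obtain ⟨q, hq, hqlt⟩ := exists_seq_of_forall_finset_exists
    (fun q : C(X, ℝ) × X => q.1 ∈ K ∧ ε ≤ |q.1 x₀ - q.1 q.2|)
    (fun q q' => |q.1 x₀ - q.1 q'.2| < ε / 2) (by
      intro s _
      have hs : ∀ᶠ y in 𝓝 x₀, ∀ q ∈ s, |q.1 x₀ - q.1 y| < ε / 2 :=
        (s.eventually_all).2 fun q _ => hnear q.1
      obtain ⟨y, ⟨f, hf, hfy⟩, hy⟩ := (hfreq.and_eventually hs).exists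
      exact ⟨(f, y), ⟨hf, hfy⟩, hy⟩)
  let f (n : ℕ) : C(X, ℝ) := (q n).1
  let U (n : ℕ) : Set X := {y | 3 / 4 * ε < |f n x₀ - f n y|} ∩
    ⋂ m ∈ Finset.range n, {y | |f m x₀ - f m y| < ε / 2}
  have hU (n : ℕ) : IsOpen (U n) ∧ (U n).Nonempty := by
    refine ⟨(isOpen_lt (by fun_prop) (by fun_prop)).inter
      (isOpen_biInter_finset fun m _ => isOpen_lt (by fun_prop) (by fun_prop)), (q n).2, ?_, ?_⟩
    · have := (hq n).2
      change 3 / 4 * ε < |(q n).1 x₀ - (q n).1 (q n).2|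
      linarith
    · simp only [Finset.mem_range, mem_iInter]
      exact fun m hm => hqlt m n hm
  obtain ⟨y, hy, φ, hφ, hA⟩ := hX U hU
  set A : Set X := closure (range (y ∘ φ))
  have : CompactSpace A := isCompact_iff_compactSpace.1 hA
  have hyA (k : ℕ) : y (φ k) ∈ A := subset_closure ⟨k, rfl⟩
  let v (k : ℕ) : A := ⟨y (φ k), hyA k⟩
  obtain ⟨z, -, hz⟩ := isCompact_univ (X := A) (f := map v atTop) (by simp)
  have hz : MapClusterPt z atTop v := hz
  have hzn (n : ℕ) : |f n x₀ - f n z| ≤ ε / 2 := by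
    have hcl : IsClosed {a : A | |f n x₀ - f n a| ≤ ε / 2} :=
      isClosed_le (by fun_prop) (by fun_prop)
    refine isClosed_iff_clusterPt.1 hcl z (ClusterPt.mono hz (le_principal_iff.2 ?_))
    rw [mem_map]
    filter_upwards [hφ.tendsto_atTop.eventually (eventually_gt_atTop n)] with k hk
    have h := (hy (φ k)).2
    simp only [Finset.mem_range, mem_iInter] at h
    exact le_of_lt (show |f n x₀ - f n (y (φ k))| < ε / 2 from h n hk)
  have hKA : IsEquicontinuousSet ((fun g : C(X, ℝ) => g.restrict A) '' K) :=
    (hK.image (ContinuousMap.continuous_restrict A)).isEquicontinuousSet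
  obtain ⟨k, hk⟩ :=
    (hz.frequently (isEquicontinuousSet_iff.1 hKA z (ε / 4) (by positivity))).exists
  have h1 : |f (φ k) z - f (φ k) (y (φ k))| < ε / 4 := hk _ ⟨_, (hq (φ k)).1, rfl⟩
  have h2 : 3 / 4 * ε < |f (φ k) x₀ - f (φ k) (y (φ k))| := (hy (φ k)).1
  linarith [hzn (φ k), abs_sub_le (f (φ k) x₀) (f (φ k) z) (f (φ k) (y (φ k)))]

theorem continuous_stoneCechRestrict (X : Type*) [TopologicalSpace X] :
    Continuous (stoneCechRestrict X) :=
  ContinuousMap.continuous_precomp _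

theorem IsAscoli.isCompactCovering_stoneCechRestrict {X : Type*} [TopologicalSpace X]
    (hA : IsAscoli X) (hX : IsPseudocompact X) : IsCompactCovering (stoneCechRestrict X) := by
  refine ⟨continuous_stoneCechRestrict X, fun K hK => ?_⟩
  have : CompactSpace K := isCompact_iff_compactSpace.1 hK
  obtain ⟨Φ, hΦ, hΦe⟩ := (hA K hK).exists_continuous_eval
  have : CompactSpace (range Φ) := isCompact_iff_compactSpace.1 (hX.isCompact_range hΦ)
  let Φ' : X → range Φ := rangeFactorization Φ
  have hΦ' : Continuous Φ' := hΦ.rangeFactorization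
  let Ψ : StoneCech X → C(K, ℝ) := fun z => (stoneCechExtend hΦ' z : range Φ)
  have hΨ : Continuous Ψ :=
    continuous_subtype_val.comp (continuous_stoneCechExtend hΦ')
  have hΨu (x : X) : Ψ (stoneCechUnit x) = Φ x := by
    simp [Ψ, Φ', stoneCechExtend_stoneCechUnit]
  let G : C(K × StoneCech X, ℝ) := ⟨fun p => Ψ p.2 p.1, by fun_prop⟩
  refine ⟨range G.curry, isCompact_range G.curry.continuous, ?_⟩
  have hG (f : K) : stoneCechRestrict X (G.curry f) = f := by
    ext x
    change Ψ (stoneCechUnit x) f = _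
    rw [hΨu, hΦe]
  rw [← range_comp]
  simp [Function.comp_def, hG]

theorem IsCompactCovering.isAscoli {X : Type*} [TopologicalSpace X]
    (h : IsCompactCovering (stoneCechRestrict X)) : IsAscoli X := by
  intro K hK
  obtain ⟨C, hC, rfl⟩ := h.2 K hK
  exact hC.isEquicontinuousSet.image_comp _

theorem IsAscoli.isSequentiallyAscoli {X : Type*} [TopologicalSpace X] (h : IsAscoli X) :
    IsSequentiallyAscoli X :=
  fun _ _ hfg => h _ hfg.isCompact_insert_range

theorem IsSequentiallyAscoli.isSelectivelyOmegaBounded {X : Type*} [TopologicalSpace X]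
    [T35Space X] (h : IsSequentiallyAscoli X) (hX : IsPseudocompact X) :
    IsSelectivelyOmegaBounded X := by
  intro U hU
  choose p hp using fun n => (hU n).2
  by_contra hcon
  have hfin (K : Set X) (hK : IsCompact K) : ∀ᶠ n in atTop, U n ∩ K = ∅ := by
    by_contra hK'
    have hfreq : ∃ᶠ n in atTop, (U n ∩ K).Nonempty := by
      simpa only [Filter.Frequently, not_nonempty_iff_eq_empty] using hK'
    obtain ⟨φ, hφ, hφK⟩ := extraction_of_frequently_atTop hfreq
    have hsel (n : ℕ) : ∃ x ∈ U n, (U n ∩ K).Nonempty → x ∈ K := by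
      by_cases hn : (U n ∩ K).Nonempty
      · exact ⟨hn.some, hn.some_mem.1, fun _ => hn.some_mem.2⟩
      · exact ⟨p n, hp n, fun h => absurd h hn⟩
    choose x hxU hxK using hsel
    refine hcon ⟨x, hxU, φ, hφ, hK.closure_of_subset ?_⟩
    rintro _ ⟨k, rfl⟩
    exact hxK _ (hφK k)
  have hbump (n : ℕ) : ∃ g : C(X, ℝ), g (p n) = 1 ∧ ∀ x ∉ U n, g x = 0 := by
    obtain ⟨g, hg, hgp, hgU⟩ := CompletelyRegularSpace.completely_regular (p n) (U n)ᶜ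
      (hU n).1.isClosed_compl (by simpa using hp n)
    exact ⟨⟨fun x => 1 - (g x : ℝ), by fun_prop⟩, by simp [hgp], fun x hx => by simp [hgU hx]⟩
  choose g hgp hgU using hbump
  have hlim : Tendsto g atTop (𝓝 0) := by
    rw [ContinuousMap.tendsto_iff_forall_isCompact_tendstoUniformlyOn]
    intro K hK
    rw [Metric.tendstoUniformlyOn_iff]
    intro ε hε
    filter_upwards [hfin K hK] with n hn x hx
    have hxU : x ∉ U n := fun hxU => (hn ▸ (⟨hxU, hx⟩ : x ∈ U n ∩ K) : x ∈ (∅ : Set X))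
    simpa [hgU n x hxU] using hε
  obtain ⟨z, hz⟩ := hX.exists_frequently_inter_nonempty (V := fun n => {x | 1 / 2 < g n x})
    (fun n => isOpen_lt (by fun_prop) (by fun_prop))
    fun n => ⟨p n, by rw [mem_ofPred_eq, hgp]; norm_num⟩
  have heq := isEquicontinuousSet_iff.1 (h g 0 hlim) z (1 / 2) (by norm_num)
  have hzU : ∀ᶠ n in atTop, g n z = 0 := by
    filter_upwards [hfin {z} isCompact_singleton] with n hn
    refine hgU n z fun hzn => ?_
    exact (hn ▸ (⟨hzn, rfl⟩ : z ∈ U n ∩ {z}) : z ∈ (∅ : Set X))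
  obtain ⟨n, ⟨w, hw1, hw2⟩, hn⟩ := ((hz _ heq).and_eventually hzU).exists
  have hw := hw2 (g n) (mem_insert_of_mem _ ⟨n, rfl⟩)
  rw [hn, zero_sub, abs_neg] at hw
  exact absurd (le_abs_self (g n w)) (by linarith [show 1 / 2 < g n w from hw1])

theorem theorem1p2 (X : Type*) [TopologicalSpace X] [T35Space X] (hX : IsPseudocompact X) :
    List.TFAE [
      IsSelectivelyOmegaBounded X,
      IsCompactCovering (stoneCechRestrict X),
      IsAscoli X,
      IsSequentiallyAscoli X] := by
  tfae_have 1 → 3 := IsSelectivelyOmegaBounded.isAscoli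
  tfae_have 3 → 2 := fun h => h.isCompactCovering_stoneCechRestrict hX
  tfae_have 2 → 3 := IsCompactCovering.isAscoli
  tfae_have 3 → 4 := IsAscoli.isSequentiallyAscoli
  tfae_have 4 → 1 := fun h => h.isSelectivelyOmegaBounded hX
  tfae_finish
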